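/- For natural numbers $k<n$ let $S^n_k=\{\alpha<\omega_n:\operatorname{cf}\alpha=\omega_k\}$. For $S\subseteq\omega_3$ let $\mathrm{Tr}(S)$ be the set of all $\gamma<\omega_3$ such that $S\cap\gamma$ is a stationary subset of $\gamma$. Call two subsets of $\omega_3$ almost disjoint if their intersection is a nonstationary subset of $\omega_3$. Proposition 3.5. Assume GCH, i.e. $2^{\kappa}=\kappa^+$ for every infinite cardinal $\kappa$. Then there are a stationary set $A\subseteq S^3_1$ and a family $\langle S_i: i<\omega_4\rangle$ of stationary sets $S_i\subseteq S^3_0$ (stationary meaning stationary in $\omega_3$) such that for every $i<\omega_4$ the set $\mathrm{Tr}(S_i)\cap A$ is stationary in $\omega_3$, and for all $i\neq j$ below $\omega_4$ the sets $\mathrm{Tr}(S_i)\cap A$ and $\mathrm{Tr}(S_j)\cap A$ are almost disjoint. -/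

import Mathlib

universe u

namespace StationaryReflection

open Cardinal Ordinal Set

/-- The generalized continuum hypothesis: `2 ^ c = c⁺` for every infinite cardinal `c`. -/
def GCH : Prop :=
  ∀ c : Cardinal.{u}, ℵ₀ ≤ c → 2 ^ c = Order.succ c

/-- `S ∩ γ` is a stationary subset of the ordinal `γ`, that is, `S` meets every closed unbounded
subset of `γ = {α | α < γ}`. -/
def StationaryIn (γ : Ordinal.{u}) (S : Set Ordinal.{u}) : Prop :=
  IsStationary {α : Iio γ | (α : Ordinal.{u}) ∈ S}

/-- The set `S^n_k` of all ordinals below `ω_n` of cofinality `ω_k`. -/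
def cofSet (n k : ℕ) : Set Ordinal.{u} :=
  {α | α < ω_ (n : Ordinal.{u}) ∧ α.cof = ℵ_ (k : Ordinal.{u})}

/-- The trace of `S ⊆ κ`: the set of all `γ < κ` at which `S` reflects, i.e. such that `S ∩ γ`
is stationary in `γ`. -/
def trace (κ : Ordinal.{u}) (S : Set Ordinal.{u}) : Set Ordinal.{u} :=
  {γ | γ < κ ∧ StationaryIn γ S}

/-- Two subsets of `κ` are almost disjoint if their intersection is a nonstationary subset
of `κ`. -/
def AlmostDisjoint (κ : Ordinal.{u}) (X Y : Set Ordinal.{u}) : Prop :=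
  ¬ StationaryIn κ (X ∩ Y)

end StationaryReflection

open Cardinal Ordinal Set StationaryReflection

open Cardinal Ordinal Set StationaryReflection

/-! Fix injections `e ξ` of each `ξ < ω₃` into `ω₂`. A set `t ⊆ ω₂` of size at most `ℵ₁` yields
small approximations `approx e t ξ ⊆ ξ`, and greedy colouring yields `r : ω₃ → ω₂` separating `ξ`
from each member of its approximation. If `cf γ = ω₁` and `γ` is closed under `f`, some `t` makes
the approximation of `γ` coherent, closed under `f`, and large enough to contain a club
(`exists_isGood`). Then `r` is injective on it, so `f` there is recorded by a set `T` of at most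
`ℵ₁` pairs of colours. By GCH there are only `ℵ₂` pairs `(t, T)`, so each `f` has one that works at
stationarily many `γ`. Coding the `ℵ₄` subsets `X` of `ω₃` by functions `ξ ↦ code of X ∩ ξ`, one
pair serves `ℵ₄` of them. Let `A` be the good points of cofinality `ω₁` and `S i` the points of
cofinality `ω` where `f i` fits. Coherence moves fitting between `γ ∈ A` and stationarily many
points below it. At a common reflection point in `A` both functions fit, hence agree on an unbounded
set, so `X i` and `X j` agree below it: common reflection points are bounded. -/

namespace StationaryReflection

/-! ### Clubs and stationary sets below an ordinal. -/

/-- `δ` is a nonzero limit of elements of `s`. -/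
def IsLimitOf (s : Set Ordinal.{u}) (δ : Ordinal.{u}) : Prop :=
  δ ≠ 0 ∧ ∀ ξ < δ, ∃ η ∈ s, ξ < η ∧ η < δ

/-- `s ∩ γ` is unbounded in `γ`. -/
def UnboundedIn (γ : Ordinal.{u}) (s : Set Ordinal.{u}) : Prop :=
  ∀ ξ < γ, ∃ η ∈ s, ξ ≤ η ∧ η < γ

/-- `C ∩ γ` is closed and unbounded in `γ`. -/
def IsClubIn (γ : Ordinal.{u}) (C : Set Ordinal.{u}) : Prop :=
  UnboundedIn γ C ∧ ∀ δ < γ, IsLimitOf C δ → δ ∈ C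

theorem IsLimitOf.mono {s t : Set Ordinal.{u}} {δ : Ordinal.{u}} (h : IsLimitOf s δ)
    (hst : s ⊆ t) : IsLimitOf t δ :=
  ⟨h.1, fun ξ hξ ↦ let ⟨η, hη, h'⟩ := h.2 ξ hξ; ⟨η, hst hη, h'⟩⟩

theorem isClub_preimage_iff {γ : Ordinal.{u}} {C : Set Ordinal.{u}} :
    IsClub {α : Iio γ | (α : Ordinal.{u}) ∈ C} ↔ IsClubIn γ C := by
  constructor
  · intro h
    refine ⟨fun ξ hξ ↦ ?_, fun δ hδ hl ↦ ?_⟩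
    · obtain ⟨η, hη, hle⟩ := h.isCofinal ⟨ξ, hξ⟩
      exact ⟨η, hη, hle, η.2⟩
    · have hd : IsLUB {α : Iio γ | (α : Ordinal.{u}) ∈ C ∧ (α : Ordinal.{u}) < δ} ⟨δ, hδ⟩ := by
        refine ⟨fun α hα ↦ hα.2.le, fun b hb ↦ ?_⟩
        by_contra hlt
        obtain ⟨η, hη, h1, h2⟩ := hl.2 b (not_le.1 hlt)
        exact (not_le.2 h1) (hb (a := ⟨η, h2.trans hδ⟩) ⟨hη, h2⟩)
      refine h.isLUB_mem (t := {α : Iio γ | (α : Ordinal.{u}) ∈ C ∧ (α : Ordinal.{u}) < δ})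
        (fun α hα ↦ hα.1) ?_ hd
      obtain ⟨η, hη, -, h2⟩ := hl.2 0 (pos_iff_ne_zero.2 hl.1)
      exact ⟨⟨η, h2.trans hδ⟩, hη, h2⟩
  · intro h
    refine ⟨fun d hd hne _ a ha ↦ ?_, fun ξ ↦ ?_⟩
    · by_cases had : a ∈ d
      · exact hd had
      have hlt : ∀ x ∈ d, x < a := fun x hx ↦
        lt_of_le_of_ne (ha.1 hx) fun e ↦ had (e ▸ hx)
      refine h.2 a a.2 ⟨?_, fun ξ hξ ↦ ?_⟩
      · obtain ⟨x, hx⟩ := hne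
        exact (bot_le.trans_lt (show (x : Ordinal.{u}) < a from hlt x hx)).ne'
      · by_contra! hcon
        have : a ≤ ⟨ξ, hξ.trans a.2⟩ := ha.2 fun x hx ↦ by
          by_contra hx'
          exact (not_le.2 (hlt x hx)) (hcon x (hd hx) (not_le.1 hx'))
        exact not_le.2 hξ this
    · obtain ⟨η, hη, h1, h2⟩ := h.1 ξ ξ.2
      exact ⟨⟨η, h2⟩, hη, h1⟩

theorem stationaryIn_iff {γ : Ordinal.{u}} {S : Set Ordinal.{u}} :
    StationaryIn γ S ↔ ∀ C, IsClubIn γ C → ∃ α ∈ S, α ∈ C ∧ α < γ := by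
  constructor
  · intro h C hC
    obtain ⟨α, h1, h2⟩ := h (isClub_preimage_iff.2 hC)
    exact ⟨α, h1, h2, α.2⟩
  · intro h t ht
    have e : t = {α : Iio γ | (α : Ordinal.{u}) ∈ Subtype.val '' t} := by
      ext α
      exact ⟨fun h ↦ ⟨α, h, rfl⟩, fun ⟨β, h, e⟩ ↦ Subtype.ext e ▸ h⟩
    rw [e] at ht ⊢
    obtain ⟨α, h1, h2, h3⟩ := h _ (isClub_preimage_iff.1 ht)
    exact ⟨⟨α, h3⟩, h1, h2⟩

theorem StationaryIn.mono_inter {γ : Ordinal.{u}} {S T : Set Ordinal.{u}} (h : StationaryIn γ S)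
    (hST : ∀ α < γ, α ∈ S → α ∈ T) : StationaryIn γ T :=
  IsStationary.mono h fun α hα ↦ hST α α.2 hα

theorem isSuccLimit_of_aleph0_lt_cof {γ : Ordinal.{u}} (hγ : ℵ₀ < γ.cof) : Order.IsSuccLimit γ :=
  one_lt_cof_iff.1 (one_lt_aleph0.trans hγ)

theorem cof_Iio_ne_aleph0 {γ : Ordinal.{u}} (hγ : ℵ₀ < γ.cof) : Order.cof (Iio γ) ≠ ℵ₀ := by
  rw [cof_Iio, ← lift_cof]
  intro h
  rw [← lift_aleph0.{u + 1, u}, Cardinal.lift_inj] at h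
  exact hγ.ne' h

theorem IsClubIn.inter {γ : Ordinal.{u}} (hγ : ℵ₀ < γ.cof) {C D : Set Ordinal.{u}}
    (hC : IsClubIn γ C) (hD : IsClubIn γ D) : IsClubIn γ (C ∩ D) :=
  isClub_preimage_iff.1 <|
    IsClub.inter (cof_Iio_ne_aleph0 hγ) (isClub_preimage_iff.2 hC) (isClub_preimage_iff.2 hD)

theorem StationaryIn.inter_club {γ : Ordinal.{u}} (hγ : ℵ₀ < γ.cof) {S C : Set Ordinal.{u}}
    (hS : StationaryIn γ S) (hC : IsClubIn γ C) : StationaryIn γ (S ∩ C) := by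
  rw [stationaryIn_iff] at hS ⊢
  intro D hD
  obtain ⟨α, h1, h2, h3⟩ := hS _ (hC.inter hγ hD)
  exact ⟨α, ⟨h1, h2.1⟩, h2.2, h3⟩

theorem StationaryIn.exists_of_iUnion {γ : Ordinal.{u}} (hγ : ℵ₀ < γ.cof) {ι : Type (u + 1)}
    (hι : #ι < Cardinal.lift.{u + 1} γ.cof) {S : ι → Set Ordinal.{u}}
    (h : StationaryIn γ (⋃ i, S i)) : ∃ i, StationaryIn γ (S i) := by
  refine (isStationary_iUnion_iff (f := fun i ↦ {α : Iio γ | (α : Ordinal.{u}) ∈ S i})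
    (cof_Iio_ne_aleph0 hγ) ?_).1 ?_
  · rwa [cof_Iio, ← lift_cof, Cardinal.lift_lt]
  · refine IsStationary.mono h fun α hα ↦ ?_
    simpa using hα

/-- The increasing sequence obtained by iterating the choice function `p` above `ξ₀`. -/
noncomputable def ascend (p : Ordinal.{u} → Ordinal.{u}) (ξ₀ j : Ordinal.{u}) : Ordinal.{u} :=
  p (max ξ₀ (⨆ k : Iio j, ascend p ξ₀ k.1 + 1))
termination_by j
decreasing_by exact k.2

theorem iSup_Iio_add_one_lt {γ j : Ordinal.{u}} (hj : j.card < γ.cof) {f : Iio j → Ordinal.{u}}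
    (hf : ∀ k, f k < γ) : ⨆ k, f k + 1 < γ := by
  refine lift_iSup_add_one_lt_of_lt_cof ?_ hf
  rwa [Cardinal.mk_Iio_ordinal, ← lift_cof, Cardinal.lift_id'.{u, u + 1}, Cardinal.lift_lt]

/-- Climb through `s` for `o` steps; fewer than `cf γ` steps stay bounded in `γ`. -/
theorem exists_isLimitOf_cof {γ o ξ₀ : Ordinal.{u}} {s : Set Ordinal.{u}} (hs : UnboundedIn γ s)
    (ho : Order.IsSuccLimit o) (hoγ : o.card < γ.cof) (hξ₀ : ξ₀ < γ) :
    ∃ δ < γ, ξ₀ < δ ∧ IsLimitOf s δ ∧ δ.cof = o.cof := by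
  choose! p hps hle hlt using hs
  let g := ascend p ξ₀
  have hg : ∀ j, g j = p (max ξ₀ (⨆ k : Iio j, g k.1 + 1)) := fun j ↦ by
    change ascend p ξ₀ j = _
    rw [ascend]
  have key : ∀ j < o, max ξ₀ (⨆ k : Iio j, g k.1 + 1) < γ := by
    intro j
    induction j using WellFoundedLT.induction with
    | ind j IH =>
      intro hj
      refine max_lt hξ₀ (iSup_Iio_add_one_lt ((card_le_card hj.le).trans_lt hoγ) fun k ↦ ?_)
      have hk := IH k k.2 (lt_trans k.2 hj)
      rw [hg]
      exact hlt _ hk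
  have hgγ : ∀ j < o, g j < γ := fun j hj ↦ by rw [hg]; exact hlt _ (key j hj)
  have hgs : ∀ j < o, g j ∈ s := fun j hj ↦ by rw [hg]; exact hps _ (key j hj)
  have hge : ∀ j < o, max ξ₀ (⨆ k : Iio j, g k.1 + 1) ≤ g j := fun j hj ↦ by
    conv_rhs => rw [hg]
    exact hle _ (key j hj)
  have hmono : ∀ j < o, ∀ k < j, g k < g j := fun j hj k hk ↦
    (Order.lt_add_one_iff.2 le_rfl).trans_le <|
      (Ordinal.le_iSup (fun k : Iio j ↦ g k.1 + 1) ⟨k, hk⟩).trans <|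
        (le_max_right _ _).trans (hge j hj)
  have hsm : StrictMono fun k : Iio o ↦ g k.1 := fun a b hab ↦ hmono b b.2 a hab
  have hlesup : ∀ j < o, g j < ⨆ k : Iio o, g k.1 + 1 := fun j hj ↦
    (Order.lt_add_one_iff.2 le_rfl).trans_le
      (Ordinal.le_iSup (fun k : Iio o ↦ g k.1 + 1) ⟨j, hj⟩)
  have ho0 : 0 < o := ho.bot_lt
  have hξδ : ξ₀ < ⨆ k : Iio o, g k.1 + 1 :=
    ((le_max_left _ _).trans (hge 0 ho0)).trans_lt (hlesup 0 ho0)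
  refine ⟨_, iSup_Iio_add_one_lt hoγ fun k ↦ hgγ k k.2, hξδ,
    ⟨(bot_le.trans_lt hξδ).ne', fun ξ hξ ↦ ?_⟩, ?_⟩
  · obtain ⟨k, hk⟩ := Ordinal.lt_iSup_iff.1 hξ
    have hk1 : k.1 + 1 < o := ho.add_one_lt k.2
    exact ⟨g (k.1 + 1), hgs _ hk1,
      (Order.lt_add_one_iff.1 hk).trans_lt (hmono _ hk1 _ (Order.lt_add_one_iff.2 le_rfl)),
      hlesup _ hk1⟩
  · exact cof_iSup_Iio_add_one hsm

theorem isClubIn_isLimitOf {γ : Ordinal.{u}} (hγ : ℵ₀ < γ.cof) {s : Set Ordinal.{u}}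
    (hs : UnboundedIn γ s) : IsClubIn γ {δ | IsLimitOf s δ} := by
  refine ⟨fun ξ hξ ↦ ?_, fun δ hδ hl ↦ ⟨hl.1, fun ξ hξ ↦ ?_⟩⟩
  · obtain ⟨δ, h1, h2, h3, -⟩ := exists_isLimitOf_cof hs isSuccLimit_omega0
      (by simpa using hγ) hξ
    exact ⟨δ, h3, h2.le, h1⟩
  · obtain ⟨η, hη, h1, h2⟩ := hl.2 ξ hξ
    obtain ⟨ζ, hζ, h3, h4⟩ := hη.2 ξ h1
    exact ⟨ζ, hζ, h3, h4.trans h2⟩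

theorem IsClubIn.of_isLimitOf {γ δ : Ordinal.{u}} {C : Set Ordinal.{u}} (hC : IsClubIn γ C)
    (hδ : δ ≤ γ) (hl : IsLimitOf C δ) : IsClubIn δ C :=
  ⟨fun ξ hξ ↦ let ⟨η, hη, h1, h2⟩ := hl.2 ξ hξ; ⟨η, hη, h1.le, h2⟩,
    fun ε hε h ↦ hC.2 ε (hε.trans_le hδ) h⟩

theorem isClubIn_Ioi {γ ξ : Ordinal.{u}} (hγ : Order.IsSuccLimit γ) (hξ : ξ < γ) :
    IsClubIn γ (Ioi ξ) := by
  refine ⟨fun η hη ↦ ⟨max η ξ + 1, ?_, ?_, hγ.add_one_lt (max_lt hη hξ)⟩, fun δ _ hl ↦ ?_⟩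
  · exact (le_max_right η ξ).trans_lt (Order.lt_add_one_iff.2 le_rfl)
  · exact (le_max_left η ξ).trans (Order.lt_add_one_iff.2 le_rfl).le
  · obtain ⟨η, hη, -, h⟩ := hl.2 0 (pos_iff_ne_zero.2 hl.1)
    exact lt_trans hη h

theorem isClubIn_closedUnder {γ : Ordinal.{u}} (hγ : ℵ₀ < γ.cof)
    (hreg : ∀ ξ < γ, ξ.card < γ.cof) {f : Ordinal.{u} → Ordinal.{u}} (hf : ∀ ξ < γ, f ξ < γ) :
    IsClubIn γ {δ | ∀ ξ < δ, f ξ < δ} := by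
  refine ⟨fun ξ₀ hξ₀ ↦ ?_, fun δ hδ hl ξ hξ ↦ ?_⟩
  · let h : Ordinal.{u} → Ordinal.{u} := fun α ↦ ⨆ ξ : Iio α, f ξ.1 + 1
    have hh : ∀ α < γ, h α < γ := fun α hα ↦
      iSup_Iio_add_one_lt (hreg α hα) fun k ↦ hf k (lt_trans k.2 hα)
    refine ⟨nfp h ξ₀, fun ξ hξ ↦ ?_, le_nfp h ξ₀, nfp_lt_ord hγ hh hξ₀⟩
    obtain ⟨n, hn⟩ := lt_nfp_iff.1 hξ
    refine lt_of_lt_of_le ?_ (iterate_le_nfp h ξ₀ (n + 1))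
    rw [Function.iterate_succ_apply']
    exact (Order.lt_add_one_iff.2 le_rfl).trans_le
      (Ordinal.le_iSup (fun ξ : Iio (h^[n] ξ₀) ↦ f ξ.1 + 1) ⟨ξ, hn⟩)
  · obtain ⟨η, hη, h1, h2⟩ := hl.2 ξ hξ
    exact (hη ξ h1).trans h2

/-! ### Cardinal arithmetic under GCH, closures, colourings and codes. -/

theorem GCH.two_power_aleph (h : GCH.{u}) (o : Ordinal.{u}) :
    (2 : Cardinal.{u + 1}) ^ ℵ_ (Ordinal.lift.{u + 1} o) = ℵ_ (Ordinal.lift.{u + 1} o + 1) := by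
  have := congrArg Cardinal.lift.{u + 1} (h (ℵ_ o) (aleph0_le_aleph o))
  rw [succ_aleph, lift_two_power, lift_aleph, lift_aleph, Ordinal.lift_add, Ordinal.lift_one]
    at this
  exact this

theorem GCH.two_power_aleph_one (h : GCH.{u}) : (2 : Cardinal.{u + 1}) ^ ℵ_ 1 = ℵ_ 2 := by
  simpa [one_add_one_eq_two] using h.two_power_aleph 1

theorem GCH.two_power_aleph_two (h : GCH.{u}) : (2 : Cardinal.{u + 1}) ^ ℵ_ 2 = ℵ_ 3 := by
  simpa [two_add_one_eq_three] using h.two_power_aleph 2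

theorem GCH.two_power_aleph_three (h : GCH.{u}) : (2 : Cardinal.{u + 1}) ^ ℵ_ 3 = ℵ_ 4 := by
  simpa [three_add_one_eq_four] using h.two_power_aleph 3

theorem mk_Iio_omega (n : ℕ) :
    #(Iio (ω_ (n : Ordinal.{u}))) = ℵ_ (n : Ordinal.{u + 1}) := by
  rw [Cardinal.mk_Iio_ordinal, card_omega, lift_aleph, Ordinal.lift_natCast]

theorem mk_Iio_le_aleph {n : ℕ} {ξ : Ordinal.{u}} (h : ξ < ω_ ((n + 1 : ℕ) : Ordinal.{u})) :
    #(Iio ξ) ≤ ℵ_ (n : Ordinal.{u + 1}) := by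
  have h2 : ξ.card ≤ ℵ_ (n : Ordinal.{u}) := by
    rw [← Order.lt_succ_iff, succ_aleph, ← lt_ord, ord_aleph]
    exact_mod_cast h
  rw [Cardinal.mk_Iio_ordinal, ← Ordinal.lift_natCast.{u + 1, u} n, ← lift_aleph, Cardinal.lift_le]
  exact h2

theorem mk_biUnion_le_of_forall_le {α β : Type u} {c : Cardinal.{u}} (hc : ℵ₀ ≤ c) {s : Set α}
    (hs : #s ≤ c) {A : α → Set β} (hA : ∀ x ∈ s, #(A x) ≤ c) : #(⋃ x ∈ s, A x) ≤ c :=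
  (mk_biUnion_le A s).trans <|
    (mul_le_mul' hs (ciSup_le' fun x : s ↦ hA x x.2)).trans (mul_eq_self hc).le

/-- Closing a set of size at most `c` under a binary operation with values of size at most `c`. -/
theorem exists_closed_superset {W : Type u} {c : Cardinal.{u}} (hc : ℵ₀ ≤ c) {G : W → W → Set W}
    (hG : ∀ v w, #(G v w) ≤ c) {u₀ : Set W} (hu₀ : #u₀ ≤ c) :
    ∃ t : Set W, u₀ ⊆ t ∧ #t ≤ c ∧ ∀ v ∈ t, ∀ w ∈ t, G v w ⊆ t := by
  let U : ℕ → Set W := fun n ↦ Nat.rec u₀ (fun _ t ↦ t ∪ ⋃ v ∈ t, ⋃ w ∈ t, G v w) n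
  have hsucc : ∀ n, U (n + 1) = U n ∪ ⋃ v ∈ U n, ⋃ w ∈ U n, G v w := fun n ↦ rfl
  have hmono : Monotone U := monotone_nat_of_le_succ fun n ↦ by
    rw [hsucc]; exact subset_union_left
  have hU : ∀ n, Cardinal.mk (↥(U n)) ≤ c := by
    intro n
    induction n with
    | zero => exact hu₀
    | succ n IH =>
      rw [hsucc]
      refine (mk_union_le _ _).trans ((add_le_add IH ?_).trans (add_eq_self hc).le)
      exact mk_biUnion_le_of_forall_le hc IH fun v _ ↦
        mk_biUnion_le_of_forall_le hc IH fun w _ ↦ hG v w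
  refine ⟨⋃ n, U n, subset_iUnion U 0, ?_, fun v hv w hw ↦ ?_⟩
  · have := mk_iUnion_le_lift U
    rw [Cardinal.lift_uzero, mk_nat, lift_aleph0] at this
    refine this.trans ((mul_le_mul' hc (ciSup_le' fun n ↦ ?_)).trans (mul_eq_self hc).le)
    simpa using hU n
  · obtain ⟨m, hm⟩ := mem_iUnion.1 hv
    obtain ⟨n, hn⟩ := mem_iUnion.1 hw
    refine fun x hx ↦ mem_iUnion.2 ⟨max m n + 1, ?_⟩
    rw [hsucc]
    exact Or.inr <| mem_biUnion (hmono (le_max_left m n) hm) <|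
      mem_biUnion (hmono (le_max_right m n) hn) hx

/-- Greedy colouring of a graph on the ordinals in which every vertex has few smaller
neighbours. -/
theorem exists_colouring {W : Type (u + 1)} (a : Ordinal.{u} → Set Ordinal.{u})
    (ha : ∀ ξ, ∀ ζ ∈ a ξ, ζ < ξ) (hcard : ∀ ξ, #(a ξ) < #W) :
    ∃ r : Ordinal.{u} → W, ∀ ξ, ∀ ζ ∈ a ξ, r ζ ≠ r ξ := by
  have : Nonempty W := mk_ne_zero_iff.1 (bot_le.trans_lt (hcard 0)).ne'
  let r : Ordinal.{u} → W := WellFounded.fix (C := fun _ ↦ W) Ordinal.lt_wf fun ξ IH ↦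
    Classical.epsilon fun w ↦ ∀ ζ (h : ζ ∈ a ξ), IH ζ (ha ξ ζ h) ≠ w
  have hr : ∀ ξ, r ξ = Classical.epsilon fun w ↦ ∀ ζ ∈ a ξ, r ζ ≠ w := fun ξ ↦
    WellFounded.fix_eq _ _ ξ
  refine ⟨r, fun ξ ↦ ?_⟩
  have hex : ∃ w, ∀ ζ ∈ a ξ, r ζ ≠ w := by
    by_contra! hcon
    have hle : #W ≤ #(r '' a ξ) := by
      rw [← mk_univ]
      exact mk_le_mk_of_subset fun w _ ↦ hcon w
    exact (hle.trans mk_image_le).not_gt (hcard ξ)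
  have := Classical.epsilon_spec hex
  rwa [← hr ξ] at this

/-- Since `2 ^ ℵ₂ = ℵ₃`, the subsets of `ξ` can be coded below `ω₃`; one value at `ξ` then recovers
`X ∩ ξ`. -/
theorem GCH.exists_codes (h : GCH.{u}) :
    ∃ F : Set Ordinal.{u} → Ordinal.{u} → Ordinal.{u}, ∀ ξ < ω_ 3,
      (∀ X, F X ξ < ω_ 3) ∧ ∀ X Y, F X ξ = F Y ξ → ∀ α < ξ, α ∈ X ↔ α ∈ Y := by
  have key : ∀ ξ : Ordinal.{u}, ξ < ω_ 3 → Nonempty (Set (Iio ξ) ↪ Iio (ω_ 3 : Ordinal.{u})) := by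
    intro ξ hξ
    have h1 := mk_Iio_le_aleph (n := 2) (ξ := ξ) (by simpa using hξ)
    have h2 := mk_Iio_omega.{u} 3
    rw [← Cardinal.le_def, mk_set]
    simp only [Nat.cast_ofNat] at h1 h2
    rw [h2, ← h.two_power_aleph_two]
    exact power_le_power_left two_ne_zero h1
  have g := fun ξ hξ ↦ (key ξ hξ).some
  classical
  refine ⟨fun X ξ ↦ if hξ : ξ < ω_ 3 then (g ξ hξ {α | (α : Ordinal.{u}) ∈ X}).1 else 0,
    fun ξ hξ ↦ ⟨fun X ↦ ?_, fun X Y hXY α hα ↦ ?_⟩⟩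
  · simp only [hξ, dite_true]
    exact (g ξ hξ _).2
  · simp only [hξ, dite_true] at hXY
    have := (g ξ hξ).injective (Subtype.ext hXY)
    exact Set.ext_iff.1 this ⟨α, hα⟩

theorem exists_injOn_Iio :
    ∃ e : Ordinal.{u} → Ordinal.{u} → Iio (ω_ 2 : Ordinal.{u}),
      ∀ ξ < ω_ 3, InjOn (e ξ) (Iio ξ) := by
  have key : ∀ ξ : Ordinal.{u}, ξ < ω_ 3 → Nonempty (Iio ξ ↪ Iio (ω_ 2 : Ordinal.{u})) := by
    intro ξ hξ
    have h1 := mk_Iio_le_aleph (n := 2) (ξ := ξ) (by simpa using hξ)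
    have h2 := mk_Iio_omega.{u} 2
    simp only [Nat.cast_ofNat] at h1 h2
    rw [← Cardinal.le_def, h2]
    exact h1
  have g := fun ξ hξ ↦ (key ξ hξ).some
  classical
  refine ⟨fun ξ ζ ↦ if h : ξ < ω_ 3 ∧ ζ < ξ then g ξ h.1 ⟨ζ, h.2⟩ else ⟨0, omega_pos 2⟩,
    fun ξ hξ ζ hζ ζ' hζ' hh ↦ ?_⟩
  simp only [mem_Iio] at hζ hζ'
  simp only [hξ, hζ, hζ', and_self, dite_true] at hh
  exact congrArg Subtype.val ((g ξ hξ).injective hh)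

theorem GCH.mk_small_sets_le (h : GCH.{u}) {α : Type (u + 1)} (hα : #α ≤ ℵ_ 2) :
    #{t : Set α // #t ≤ ℵ_ 1} ≤ ℵ_ 2 := by
  refine (mk_bounded_set_le α _).trans ?_
  refine (power_le_power_right (max_le hα (aleph0_le_aleph 2))).trans ?_
  rw [← h.two_power_aleph_one, ← power_mul, mul_eq_self (aleph0_le_aleph 1)]

theorem exists_small_club {γ : Ordinal.{u}} (hγ : γ.cof = ℵ_ 1) :
    ∃ C : Set Ordinal.{u}, IsClubIn γ C ∧ C ⊆ Iio γ ∧ #C ≤ ℵ_ 1 := by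
  have hunc : ℵ₀ < γ.cof := by rw [hγ]; exact aleph0_lt_aleph_one
  obtain ⟨s, hs, hcard⟩ := Order.exists_cof_eq (Iio γ)
  have hunb : UnboundedIn γ (Subtype.val '' s) := fun ξ hξ ↦
    let ⟨η, hη, hle⟩ := hs ⟨ξ, hξ⟩
    ⟨η, mem_image_of_mem _ hη, hle, η.2⟩
  have hclub := isClubIn_isLimitOf hunc hunb
  refine ⟨{δ | IsLimitOf (Subtype.val '' s) δ} ∩ Iio γ, ⟨fun ξ hξ ↦ ?_, fun δ hδ h ↦ ?_⟩,
    inter_subset_right, ?_⟩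
  · obtain ⟨η, h1, h2, h3⟩ := hclub.1 ξ hξ
    exact ⟨η, ⟨h1, h3⟩, h2, h3⟩
  · exact ⟨hclub.2 δ hδ (h.mono inter_subset_left), hδ⟩
  -- Sending a limit point to the least element of `s` above or equal to it is injective, so there
  -- are no more limit points than elements of `s`.
  · let m : Ordinal.{u} → Ordinal.{u} := fun δ ↦ sInf {η ∈ Subtype.val '' s | δ ≤ η}
    have hm : ∀ δ < γ, m δ ∈ Subtype.val '' s ∧ δ ≤ m δ := fun δ hδ ↦
      csInf_mem (s := {η ∈ Subtype.val '' s | δ ≤ η})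
        (let ⟨η, h1, h2, _⟩ := hunb δ hδ; ⟨η, h1, h2⟩)
    have hmono : StrictMonoOn m ({δ | IsLimitOf (Subtype.val '' s) δ} ∩ Iio γ) := by
      intro δ _ δ' hδ' hlt
      obtain ⟨η, hη, h1, h2⟩ := hδ'.1.2 δ hlt
      exact (csInf_le' (s := {η ∈ Subtype.val '' s | δ ≤ η}) ⟨hη, h1.le⟩).trans_lt
        (h2.trans_le (hm δ' hδ'.2).2)
    rw [← mk_image_eq_of_injOn _ _ hmono.injOn]
    refine (mk_le_mk_of_subset (t := Subtype.val '' s) ?_).trans (mk_image_le.trans ?_)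
    · rintro _ ⟨δ, hδ, rfl⟩
      exact (hm δ hδ.2).1
    · rw [hcard, cof_Iio, ← lift_cof, hγ, lift_aleph, Ordinal.lift_one]

/-! ### Coherent approximations and functions read through colours. -/

section Approx

variable {W : Type (u + 1)}

/-- The ordinals below `ξ` whose index, in the enumeration `e ξ` of `ξ`, lies in `t`. -/
def approx (e : Ordinal.{u} → Ordinal.{u} → W) (t : Set W) (ξ : Ordinal.{u}) : Set Ordinal.{u} :=
  {ζ | ζ < ξ ∧ e ξ ζ ∈ t}

/-- The approximation of `γ` given by `t` contains a club of `γ` and is coherent with the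
approximations of its elements. -/
def IsGood (e : Ordinal.{u} → Ordinal.{u} → W) (t : Set W) (γ : Ordinal.{u}) : Prop :=
  (∀ β ∈ approx e t γ, approx e t β = approx e t γ ∩ Iio β) ∧
    ∃ C, IsClubIn γ C ∧ C ∩ Iio γ ⊆ approx e t γ

/-- The approximation of `γ` is closed under `f`, and the relation `T` between colours
accommodates `f`. -/
def Fits (e : Ordinal.{u} → Ordinal.{u} → W) (r : Ordinal.{u} → W) (t : Set W) (T : Set (W × W))
    (f : Ordinal.{u} → Ordinal.{u}) (γ : Ordinal.{u}) : Prop :=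
  ∀ ξ ∈ approx e t γ, f ξ ∈ approx e t γ ∧ (r ξ, r (f ξ)) ∈ T

theorem mk_approx_le {e : Ordinal.{u} → Ordinal.{u} → W} {ξ : Ordinal.{u}}
    (he : InjOn (e ξ) (Iio ξ)) (t : Set W) : #(approx e t ξ) ≤ #t := by
  rw [← mk_image_eq_of_injOn (e ξ) _ (he.mono fun ζ hζ ↦ hζ.1)]
  refine mk_le_mk_of_subset ?_
  rintro _ ⟨ζ, hζ, rfl⟩
  exact hζ.2

theorem exists_isGood {e : Ordinal.{u} → Ordinal.{u} → W} {γ : Ordinal.{u}}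
    (he : ∀ ξ ≤ γ, InjOn (e ξ) (Iio ξ)) (hγ : γ.cof = ℵ_ 1) {f : Ordinal.{u} → Ordinal.{u}}
    (hf : ∀ ξ < γ, f ξ < γ) :
    ∃ t : Set W, #t ≤ ℵ_ 1 ∧ IsGood e t γ ∧ ∀ ξ ∈ approx e t γ, f ξ ∈ approx e t γ := by
  obtain ⟨C, hC, hCγ, hcard⟩ := exists_small_club hγ
  let i : Ordinal.{u} → W → Ordinal.{u} := fun ξ ↦ Function.invFunOn (e ξ) (Iio ξ)
  have hi : ∀ ξ ≤ γ, ∀ ζ < ξ, i ξ (e ξ ζ) = ζ := fun ξ hξ ζ hζ ↦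
    (he ξ hξ).leftInvOn_invFunOn hζ
  -- The first two entries give the two inclusions of coherence, the third gives closure under `f`.
  let G : W → W → Set W := fun v w ↦
    {e (i γ v) (i γ w), e γ (i (i γ v) w), e γ (f (i γ v))}
  have hG : ∀ v w, #(G v w) ≤ ℵ_ 1 := fun v w ↦
    (le_aleph0_iff_set_countable.2 (Set.toFinite _).countable).trans (aleph0_le_aleph 1)
  obtain ⟨t, h0, ht, hcl⟩ := exists_closed_superset (aleph0_le_aleph 1) hG
    (u₀ := e γ '' C) (mk_image_le.trans hcard)
  refine ⟨t, ht, ⟨fun β hβ ↦ ?_, C, hC, fun ξ hξ ↦ ⟨hξ.2, h0 (mem_image_of_mem _ hξ.1)⟩⟩,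
    fun ξ hξ ↦ ⟨hf ξ hξ.1, ?_⟩⟩
  · ext ζ
    constructor
    · intro hζ
      refine ⟨⟨hζ.1.trans hβ.1, ?_⟩, hζ.1⟩
      have := hcl _ hβ.2 _ hζ.2 (Or.inr (Or.inl rfl))
      rwa [hi γ le_rfl β hβ.1, hi β hβ.1.le ζ hζ.1] at this
    · intro hζ
      refine ⟨hζ.2, ?_⟩
      have := hcl _ hβ.2 _ hζ.1.2 (Or.inl rfl)
      rwa [hi γ le_rfl β hβ.1, hi γ le_rfl ζ hζ.1.1] at this
  · have := hcl _ hξ.2 _ hξ.2 (Or.inr (Or.inr rfl))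
    rwa [hi γ le_rfl ξ hξ.1] at this

variable {e : Ordinal.{u} → Ordinal.{u} → W} {r : Ordinal.{u} → W} {t : Set W} {T : Set (W × W)}
  {γ : Ordinal.{u}} {f : Ordinal.{u} → Ordinal.{u}}

/-- Coherence puts the smaller of two members into the approximation of the larger, where the
colouring separates them. -/
theorem IsGood.injOn (h : IsGood e t γ)
    (hr : ∀ ξ < γ, ∀ ζ ∈ approx e t ξ, r ζ ≠ r ξ) : InjOn r (approx e t γ) := by
  have key : ∀ ζ ∈ approx e t γ, ∀ ξ ∈ approx e t γ, ζ < ξ → r ζ ≠ r ξ := fun ζ hζ ξ hξ hlt ↦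
    hr ξ hξ.1 ζ (by rw [h.1 ξ hξ]; exact ⟨hζ, hlt⟩)
  intro ζ hζ ξ hξ heq
  rcases lt_trichotomy ζ ξ with hlt | rfl | hlt
  · exact absurd heq (key ζ hζ ξ hξ hlt)
  · rfl
  · exact absurd heq.symm (key ξ hξ ζ hζ hlt)

/-- Fitting passes from `γ` to stationarily many ordinals of countable cofinality below `γ`. -/
theorem Fits.stationaryIn (hfit : Fits e r t T f γ) (h : IsGood e t γ) (hγ : γ.cof = ℵ_ 1)
    (hE : IsLimitOf {δ | ∀ ξ < δ, f ξ < δ} γ)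
    (hEc : IsClubIn γ {δ | ∀ ξ < δ, f ξ < δ}) :
    StationaryIn γ {β | β.cof = ℵ₀ ∧ Fits e r t T f β} := by
  have hunc : ℵ₀ < γ.cof := by rw [hγ]; exact aleph0_lt_aleph_one
  obtain ⟨hcoh, C, hC, hCsub⟩ := h
  rw [stationaryIn_iff]
  intro K hK
  have hD := (hC.inter hunc hEc).inter hunc hK
  obtain ⟨β, h1, -, h3, h4⟩ := exists_isLimitOf_cof hD.1 isSuccLimit_omega0
    (by simpa using hunc) (pos_iff_ne_zero.2 hE.1)
  obtain ⟨⟨hβC, hβE⟩, hβK⟩ := hD.2 β h1 h3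
  have hβ : β ∈ approx e t γ := hCsub ⟨hβC, h1⟩
  refine ⟨β, ⟨by rw [h4, cof_omega0], fun ξ hξ ↦ ?_⟩, hβK, h1⟩
  rw [hcoh β hβ] at hξ ⊢
  exact ⟨⟨(hfit ξ hξ.1).1, hβE ξ hξ.2⟩, (hfit ξ hξ.1).2⟩

/-- Any `ξ` lies below some `β ∈ S ∩ C`, whose approximation is by coherence an initial part of that
of `γ`. -/
theorem Fits.of_stationaryIn (h : IsGood e t γ) (hγ : γ.cof = ℵ_ 1) {S : Set Ordinal.{u}}
    (hS : StationaryIn γ S) (hfit : ∀ β ∈ S, Fits e r t T f β) : Fits e r t T f γ := by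
  have hunc : ℵ₀ < γ.cof := by rw [hγ]; exact aleph0_lt_aleph_one
  obtain ⟨hcoh, C, hC, hCsub⟩ := h
  intro ξ hξ
  obtain ⟨β, hβS, ⟨hβC, hξβ⟩, hβγ⟩ := stationaryIn_iff.1 hS _
    (hC.inter hunc (isClubIn_Ioi (isSuccLimit_of_aleph0_lt_cof hunc) hξ.1))
  have hβ := hfit β hβS ξ
  rw [hcoh β (hCsub ⟨hβC, hβγ⟩)] at hβ
  obtain ⟨h1, h2⟩ := hβ ⟨hξ, hξβ⟩
  exact ⟨h1.1, h2⟩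

/-- If the colours are injective on the approximation and `T` is functional, then at most one
function fits. -/
theorem Fits.eqOn {g : Ordinal.{u} → Ordinal.{u}} (hr : InjOn r (approx e t γ))
    (hT : ∀ v w w', (v, w) ∈ T → (v, w') ∈ T → w = w')
    (hf : Fits e r t T f γ) (hg : Fits e r t T g γ) : EqOn f g (approx e t γ) := fun ξ hξ ↦
  hr (hf ξ hξ).1 (hg ξ hξ).1 (hT _ _ _ (hf ξ hξ).2 (hg ξ hξ).2)

end Approx

/-! ### Pigeonhole arguments on `ω₃`. -/

theorem cof_omega_three : (ω_ 3 : Ordinal.{u}).cof = ℵ_ 3 := by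
  simpa [two_add_one_eq_three] using Cardinal.cof_omega_add_one.{u} 2

theorem aleph0_lt_cof_omega_three : ℵ₀ < (ω_ 3 : Ordinal.{u}).cof := by
  rw [cof_omega_three, ← aleph_zero]
  exact aleph_lt_aleph.2 (by norm_num)

theorem card_lt_cof_omega_three {ξ : Ordinal.{u}} (h : ξ < ω_ 3) :
    ξ.card < (ω_ 3 : Ordinal.{u}).cof := by
  rw [cof_omega_three, ← lt_ord, ord_aleph]
  exact h

theorem stationaryIn_cofSet_three_one : StationaryIn (ω_ 3) (cofSet.{u} 3 1) := by
  rw [stationaryIn_iff]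
  intro C hC
  obtain ⟨δ, h1, -, h3, h4⟩ := exists_isLimitOf_cof (o := ω_ 1) hC.1
    (isSuccLimit_omega 1) (card_lt_cof_omega_three (omega_lt_omega.2 (by norm_num)))
    (omega_pos 3)
  refine ⟨δ, ⟨by simpa using h1, ?_⟩, hC.2 δ h1 h3, h1⟩
  rw [h4, cof_omega_one, Nat.cast_one]

/-- The indices `(t, T)`: small sets of indices and small sets of pairs of colours. -/
abbrev SmallPair (W : Type u) : Type u :=
  {t : Set W // #t ≤ ℵ_ 1} × {T : Set (W × W) // #T ≤ ℵ_ 1}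

theorem GCH.mk_smallPair_le (h : GCH.{u}) {W : Type (u + 1)} (hW : #W ≤ ℵ_ 2) :
    #(SmallPair W) ≤ ℵ_ 2 := by
  rw [mk_prod, Cardinal.lift_id, Cardinal.lift_id]
  refine (mul_le_mul' (h.mk_small_sets_le hW) (h.mk_small_sets_le ?_)).trans
    (mul_eq_self (aleph0_le_aleph 2)).le
  rw [mk_prod, Cardinal.lift_id]
  exact (mul_le_mul' hW hW).trans (mul_eq_self (aleph0_le_aleph 2)).le

/-- Every function on `ω₃` fits stationarily often with respect to some index. -/
theorem GCH.exists_stationaryIn_fits (h : GCH.{u}) {W : Type (u + 1)} (hW : #W ≤ ℵ_ 2)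
    {e : Ordinal.{u} → Ordinal.{u} → W} (he : ∀ ξ < ω_ 3, InjOn (e ξ) (Iio ξ))
    {r : Set W → Ordinal.{u} → W}
    (hr : ∀ t : Set W, #t ≤ ℵ_ 1 → ∀ ξ < ω_ 3, ∀ ζ ∈ approx e t ξ, r t ζ ≠ r t ξ)
    {f : Ordinal.{u} → Ordinal.{u}} (hf : ∀ ξ < ω_ 3, f ξ < ω_ 3) :
    ∃ q : SmallPair W, (∀ v w w', (v, w) ∈ q.2.1 → (v, w') ∈ q.2.1 → w = w') ∧
      StationaryIn (ω_ 3) {γ | γ ∈ cofSet 3 1 ∧ IsGood e q.1.1 γ ∧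
        Fits e (r q.1.1) q.1.1 q.2.1 f γ} := by
  have hE := isClubIn_closedUnder aleph0_lt_cof_omega_three
    (fun ξ hξ ↦ card_lt_cof_omega_three hξ) hf
  have hst := stationaryIn_cofSet_three_one.inter_club aleph0_lt_cof_omega_three hE
  have hlt : #(SmallPair W) < Cardinal.lift.{u + 1} (ω_ 3 : Ordinal.{u}).cof := by
    refine (h.mk_smallPair_le hW).trans_lt ?_
    rw [cof_omega_three, lift_aleph, aleph_lt_aleph]
    simpa using (by norm_num : (2 : Ordinal.{u + 1}) < 3)
  -- Functionality of `T` does not depend on `γ`; it is carried inside the set so that it can be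
  -- read off any element of the stationary piece.
  have hcov : StationaryIn (ω_ 3) (⋃ q : SmallPair W,
      {γ | (∀ v w w', (v, w) ∈ q.2.1 → (v, w') ∈ q.2.1 → w = w') ∧
        γ ∈ cofSet 3 1 ∧ IsGood e q.1.1 γ ∧ Fits e (r q.1.1) q.1.1 q.2.1 f γ}) := by
    refine hst.mono_inter ?_
    rintro γ hγ ⟨hγ1, hγE⟩
    have hcof : γ.cof = ℵ_ 1 := by simpa using hγ1.2
    obtain ⟨t, ht, hgood, hcl⟩ := exists_isGood (fun ξ hξ ↦ he ξ (hξ.trans_lt hγ)) hcof hγE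
    let T : Set (W × W) := (fun ξ ↦ (r t ξ, r t (f ξ))) '' approx e t γ
    have hT : #T ≤ ℵ_ 1 := mk_image_le.trans ((mk_approx_le (he γ hγ) t).trans ht)
    have hinj := hgood.injOn fun ξ hξ ↦ hr t ht ξ (hξ.trans hγ)
    refine mem_iUnion.2 ⟨(⟨t, ht⟩, ⟨T, hT⟩), ?_, hγ1, hgood, fun ξ hξ ↦
      ⟨hcl ξ hξ, mem_image_of_mem _ hξ⟩⟩
    rintro v w w' ⟨ξ, hξ, h1⟩ ⟨ζ, hζ, h2⟩
    simp only [Prod.mk.injEq] at h1 h2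
    have : ξ = ζ := hinj hξ hζ (h1.1.trans h2.1.symm)
    rw [← h1.2, ← h2.2, this]
  obtain ⟨q, hq⟩ := hcov.exists_of_iUnion aleph0_lt_cof_omega_three hlt
  obtain ⟨α, hα⟩ := IsStationary.nonempty hq
  exact ⟨q, hα.1, hq.mono_inter fun α _ hα ↦ hα.2⟩

/-- Among the `ℵ₄` subsets of `ω₃`, there are `ℵ₄` many on which a map to a set of size `ℵ₂`
is constant. -/
theorem GCH.exists_constant_family (h : GCH.{u}) {I : Type (u + 1)} (hI : #I ≤ ℵ_ 2)
    (q : Set (Iio (ω_ 3 : Ordinal.{u})) → I) :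
    ∃ (q₀ : I) (X : Iio (ω_ 4 : Ordinal.{u}) → Set (Iio (ω_ 3 : Ordinal.{u}))),
      Function.Injective X ∧ ∀ i, q (X i) = q₀ := by
  have h3 := mk_Iio_omega.{u} 3
  have h4 := mk_Iio_omega.{u} 4
  simp only [Nat.cast_ofNat] at h3 h4
  have hcard : #(Set (Iio (ω_ 3 : Ordinal.{u}))) = ℵ_ 4 := by
    rw [mk_set, h3, h.two_power_aleph_three]
  have hreg : (ℵ_ 4 : Cardinal.{u + 1}).IsRegular := by
    simpa [three_add_one_eq_four] using isRegular_aleph_add_one.{u + 1} 3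
  obtain ⟨q₀, hq₀⟩ := infinite_pigeonhole q (by rw [hcard]; exact aleph0_le_aleph 4) (by
    rw [hcard, hreg.cof_ord]
    exact hI.trans_lt (aleph_lt_aleph.2 (by norm_num)))
  rw [hcard, ← h4] at hq₀
  obtain ⟨φ⟩ := Cardinal.eq.1 hq₀
  exact ⟨q₀, fun i ↦ (φ.symm i).1, Subtype.val_injective.comp φ.symm.injective,
    fun i ↦ (φ.symm i).2⟩

end StationaryReflection

/-! ### Assembly of `A` and the sets `S i`. -/

theorem proposition3p5 (hGCH : GCH.{u}) :
    ∃ A : Set Ordinal.{u}, A ⊆ cofSet 3 1 ∧ StationaryIn (ω_ 3) A ∧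
      ∃ S : Iio (ω_ 4 : Ordinal.{u}) → Set Ordinal.{u},
        (∀ i, S i ⊆ cofSet 3 0 ∧ StationaryIn (ω_ 3) (S i)) ∧
        (∀ i, StationaryIn (ω_ 3) (trace (ω_ 3) (S i) ∩ A)) ∧
        (∀ i j, i ≠ j →
          AlmostDisjoint (ω_ 3) (trace (ω_ 3) (S i) ∩ A) (trace (ω_ 3) (S j) ∩ A)) := by
  obtain ⟨F, hF⟩ := hGCH.exists_codes
  obtain ⟨e, he⟩ := exists_injOn_Iio.{u}
  have hWeq : #(Iio (ω_ 2 : Ordinal.{u})) = ℵ_ 2 := mk_Iio_omega.{u} 2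
  have hcol : ∀ t : Set (Iio (ω_ 2 : Ordinal.{u})), ∃ r : Ordinal.{u} → Iio (ω_ 2 : Ordinal.{u}),
      #t ≤ ℵ_ 1 → ∀ ξ < ω_ 3, ∀ ζ ∈ approx e t ξ, r ζ ≠ r ξ := by
    intro t
    by_cases ht : #t ≤ ℵ_ 1
    · obtain ⟨r, hr⟩ := exists_colouring (W := Iio (ω_ 2 : Ordinal.{u}))
        (fun ξ ↦ {ζ | ξ < ω_ 3 ∧ ζ ∈ approx e t ξ}) (fun ξ ζ hζ ↦ hζ.2.1) fun ξ ↦ by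
          have h12 : (ℵ_ 1 : Cardinal.{u + 1}) < ℵ_ 2 := aleph_lt_aleph.2 (by norm_num)
          rw [hWeq]
          refine lt_of_le_of_lt ?_ h12
          by_cases hξ : ξ < ω_ 3
          · refine (mk_le_mk_of_subset fun ζ hζ ↦ ?_).trans ((mk_approx_le (he ξ hξ) t).trans ht)
            exact hζ.2
          · simp [hξ]
      exact ⟨r, fun _ ξ hξ ζ hζ ↦ hr ξ ζ ⟨hξ, hζ⟩⟩
    -- Large `t` get a dummy colouring.
    · exact ⟨fun _ ↦ ⟨0, omega_pos 2⟩, fun h ↦ absurd h ht⟩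
  choose r hr using hcol
  have hfun := fun X : Set (Iio (ω_ 3 : Ordinal.{u})) ↦
    hGCH.exists_stationaryIn_fits hWeq.le he hr (f := F (Subtype.val '' X))
      fun ξ hξ ↦ (hF ξ hξ).1 _
  choose q hqT hqst using hfun
  obtain ⟨q₀, X, hX, hXq⟩ := hGCH.exists_constant_family (hGCH.mk_smallPair_le hWeq.le) q
  let f : Iio (ω_ 4 : Ordinal.{u}) → Ordinal.{u} → Ordinal.{u} := fun i ↦ F (Subtype.val '' X i)
  have hT : ∀ i : Iio (ω_ 4 : Ordinal.{u}),
      ∀ v w w', (v, w) ∈ q₀.2.1 → (v, w') ∈ q₀.2.1 → w = w' := fun i ↦ hXq i ▸ hqT (X i)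
  have hB : ∀ i, StationaryIn (ω_ 3) {γ | γ ∈ cofSet 3 1 ∧ IsGood e q₀.1.1 γ ∧
      Fits e (r q₀.1.1) q₀.1.1 q₀.2.1 (f i) γ} := fun i ↦ by
    have := hqst (X i)
    rwa [hXq i] at this
  have hE : ∀ i, IsClubIn (ω_ 3) {δ | ∀ ξ < δ, f i ξ < δ} := fun i ↦
    isClubIn_closedUnder aleph0_lt_cof_omega_three (fun ξ hξ ↦ card_lt_cof_omega_three hξ)
      fun ξ hξ ↦ (hF ξ hξ).1 _
  let S : Iio (ω_ 4 : Ordinal.{u}) → Set Ordinal.{u} := fun i ↦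
    {β | β ∈ cofSet 3 0 ∧ Fits e (r q₀.1.1) q₀.1.1 q₀.2.1 (f i) β}
  have htr : ∀ i, StationaryIn (ω_ 3)
      (trace (ω_ 3) (S i) ∩ {γ | γ ∈ cofSet 3 1 ∧ IsGood e q₀.1.1 γ}) := by
    intro i
    -- Restricting to limits of closure points of `f i` makes these a club in `γ`, as needed to pass
    -- fitting downwards.
    refine ((hB i).inter_club aleph0_lt_cof_omega_three
      (isClubIn_isLimitOf aleph0_lt_cof_omega_three (hE i).1)).mono_inter ?_
    rintro γ hγ ⟨⟨h1, h2, h3⟩, h4⟩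
    refine ⟨⟨hγ, ?_⟩, h1, h2⟩
    refine (h3.stationaryIn h2 (by simpa using h1.2) h4
      ((hE i).of_isLimitOf hγ.le h4)).mono_inter fun β hβ h ↦ ⟨⟨?_, ?_⟩, h.2⟩
    · simpa using hβ.trans hγ
    · simpa using h.1
  refine ⟨{γ | γ ∈ cofSet 3 1 ∧ IsGood e q₀.1.1 γ}, fun γ hγ ↦ hγ.1,
    (htr ⟨0, omega_pos 4⟩).mono_inter fun γ _ h ↦ h.2, S, fun i ↦ ⟨fun β hβ ↦ hβ.1, ?_⟩, htr, ?_⟩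
  -- A set reflecting stationarily often is stationary: a club is still a club below any of its
  -- limits.
  · rw [stationaryIn_iff]
    intro C hC
    obtain ⟨γ, hγS, hγC, hγ⟩ := stationaryIn_iff.1 (htr i) _
      (isClubIn_isLimitOf aleph0_lt_cof_omega_three hC.1)
    obtain ⟨β, h1, h2, h3⟩ := stationaryIn_iff.1 hγS.1.2 _ (hC.of_isLimitOf hγ.le hγC)
    exact ⟨β, h1, h2, h3.trans hγ⟩
  · intro i j hij hst
    obtain ⟨δ, hδ⟩ : ∃ δ, ¬ (δ ∈ X i ↔ δ ∈ X j) := by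
      by_contra! hcon
      exact hij (hX (Set.ext hcon))
    obtain ⟨γ, ⟨⟨h1, hγA⟩, h2, -⟩, hδγ, hγ⟩ := stationaryIn_iff.1 hst _
      (isClubIn_Ioi (isSuccLimit_of_aleph0_lt_cof aleph0_lt_cof_omega_three) δ.2)
    have hcof : γ.cof = ℵ_ 1 := by simpa using hγA.1.2
    have heq := Fits.eqOn (hγA.2.injOn fun ξ hξ ↦ hr _ q₀.1.2 ξ (hξ.trans hγ)) (hT i)
      (Fits.of_stationaryIn hγA.2 hcof h1.2 fun β hβ ↦ hβ.2)
      (Fits.of_stationaryIn hγA.2 hcof h2.2 fun β hβ ↦ hβ.2)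
    have hlim := isSuccLimit_of_aleph0_lt_cof (hcof ▸ aleph0_lt_aleph_one)
    obtain ⟨C, hC, hCsub⟩ := hγA.2.2
    -- A point `η > δ` of the common approximation: equal codes at `η` force `X i` and `X j` to
    -- agree at `δ`.
    obtain ⟨η, hη, hle, hηγ⟩ := hC.1 _ (hlim.add_one_lt hδγ)
    have := (hF η (hηγ.trans hγ)).2 _ _ (heq (hCsub ⟨hη, hηγ⟩)) δ
      ((Order.lt_add_one_iff.2 le_rfl).trans_le hle)
    exact hδ (by simpa [show (δ : Ordinal.{u}) < ω_ 3 from δ.2] using this)
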